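/- Throughout, a bipartite graph has two finite layers, an upper layer $U$ and a lower layer $V$. A \emph{face graph} is a bipartite graph that has a perfect matching and in which every edge lies in a perfect matching. A perfect matching is a bijection $\sigma\colon U\to V$ with $(u,\sigma(u))$ an edge for all $u$; its matrix $M(\sigma)\in\mathbb R^{U\times V}$ has entry $1$ at $(u,\sigma(u))$ for all $u\in U$ and $0$ elsewhere. The \emph{face} $\mathcal F(G)$ of a face graph $G$ is the convex hull of the matrices $M(\sigma)$ of its perfect matchings $\sigma$ (this is a face of the Birkhoff polytope). Let $G$ be a nonempty face graph with connected components $G^1,\dots,G^c$, listed in some order. A choice of nodes $S(G)=\{u^1,v^1,\dots,u^c,v^c\}$, with $u^j$ in the upper and $v^j$ in the lower layer of $G^j$, is \emph{pyramidal} if $G-S(G)$ has a unique perfect matching. Let $G_1,\dots,G_k$ be nonempty face graphs, $k\ge 2$, with components $G_i^1,\dots,G_i^{c_i}$ and chosen nodes $S(G_i)=\{u_i^j,v_i^j \mid 1\le j\le c_i\}$. The \emph{joined product graph} $\mathcal{JPG}(G_1,\dots,G_k)$ is the disjoint union of $G_1,\dots,G_k$ and two extra nodes, $u$ in the upper and $v$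 in the lower layer, together with the edges $(u,v_i^{c_i})$ and $(v,u_i^1)$ for $1\le i\le k$ and $(v_i^j,u_i^{j+1})$ for $1\le i\le k$, $1\le j\le c_i-1$. The \emph{reduced joined product graph} $\mathcal{JPG}^{\mathrm{red}}(G_1,\dots,G_k)$ has in addition the edge $(u,v)$. For polytopes $P_i\subset\mathbb R^{d_i}$, $1\le i\le k$, let $Q_0=P_1\times\cdots\times P_k$ and let $Q_i=P_1\times\cdots\times P_{i-1}\times\{0\}\times P_{i+1}\times\cdots\times P_k$ for $1\le i\le k$. The \emph{Cayley sum} of a finite family of polytopes $R_j$ in a common space is the convex hull of the union of the sets $R_j\times\{e_j\}$, with $e_j$ the unit vectors. The \emph{joined product} of $P_1,\dots,P_k$ is the Cayley sum of $Q_1,\dots,Q_k$, and the \emph{reduced joined product} is the Cayley sum of $Q_0,Q_1,\dots,Q_k$. \textbf{Theorem.} Let $k\ge 2$, let $G_1,\dots,G_k$ be nonempty face graphs with pyramidal choices $S(G_i)$ of nodes, and let $F_i=\mathcal F(G_i)$. \begin{enumerate} \item $\mathcal{JPG}(G_1,\dots,G_k)$ is a face graph, and its face is affinely isomorphic to the joined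 product of $F_1,\dots,F_k$. \item $\mathcal{JPG}^{\mathrm{red}}(G_1,\dots,G_k)$ is a face graph, and its face is affinely isomorphic to the reduced joined product of $F_1,\dots,F_k$. \end{enumerate} -/

import Mathlib

/-- A bipartite graph with upper layer `U` and lower layer `V`, given by its edge relation. -/
structure BipGraph (U V : Type*) where
  /-- `Adj u v`: there is an edge between the upper node `u` and the lower node `v`. -/
  Adj : U → V → Prop

namespace BipGraph

variable {U V : Type*}

/-- The underlying simple graph on the disjoint union of the two layers. -/
def toSimpleGraph (G : BipGraph U V) : SimpleGraph (U ⊕ V) where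
  Adj
    | .inl u, .inr v => G.Adj u v
    | .inr v, .inl u => G.Adj u v
    | _, _ => False
  symm := ⟨by rintro (u | v) (u' | v') h <;> exact h⟩
  loopless := ⟨by rintro (u | v) h <;> exact h⟩

/-- The subgraph induced on the upper nodes in `A` and the lower nodes in `B`. -/
def induce (G : BipGraph U V) (A : Set U) (B : Set V) : BipGraph A B where
  Adj u v := G.Adj u v

/-- A perfect matching of a bipartite graph, seen as the bijection from the upper to the lower
layer that maps each upper node to the lower node it is matched with. -/
def IsPerfectMatching (G : BipGraph U V) (σ : U ≃ V) : Prop :=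
  ∀ u, G.Adj u (σ u)

/-- A face graph: the graph has a perfect matching, and every edge lies in a perfect matching.
(The first condition only excludes graphs that have nodes but no edges.) -/
def IsFaceGraph (G : BipGraph U V) : Prop :=
  (∃ σ : U ≃ V, G.IsPerfectMatching σ) ∧
    ∀ u v, G.Adj u v → ∃ σ : U ≃ V, G.IsPerfectMatching σ ∧ σ u = v

open Classical in
/-- The `0/1` matrix of a bijection: the entry at `(u, v)` is `1` iff `σ u = v`. -/
noncomputable def matchingMatrix (σ : U ≃ V) : Matrix U V ℝ :=
  Matrix.of fun u v => if σ u = v then 1 else 0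

/-- The face of the Birkhoff polytope defined by a face graph: the convex hull of the permutation
matrices of the perfect matchings of the graph. -/
noncomputable def face (G : BipGraph U V) : Set (Matrix U V ℝ) :=
  convexHull ℝ {M | ∃ σ : U ≃ V, G.IsPerfectMatching σ ∧ M = matchingMatrix σ}

/-- A choice of an upper and a lower node in each connected component of a nonempty bipartite
graph, whose components are listed (without repetition) in some order as components number
`0, …, last`. -/
structure NodeChoice (G : BipGraph U V) where
  /-- the index of the last component; there are `last + 1` components -/
  last : ℕ
  /-- the list of all connected components -/
  comp : Fin (last + 1) ≃ G.toSimpleGraph.ConnectedComponent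
  /-- the chosen upper nodes -/
  up : Fin (last + 1) → U
  /-- the chosen lower nodes -/
  low : Fin (last + 1) → V
  up_mem : ∀ j, Sum.inl (up j) ∈ (comp j).supp
  low_mem : ∀ j, Sum.inr (low j) ∈ (comp j).supp

/-- A choice of nodes is pyramidal if the graph without the chosen nodes has exactly one perfect
matching. -/
def NodeChoice.IsPyramidal {G : BipGraph U V} (S : G.NodeChoice) : Prop :=
  ∃! σ : ↥(Set.range S.up)ᶜ ≃ ↥(Set.range S.low)ᶜ,
    (G.induce (Set.range S.up)ᶜ (Set.range S.low)ᶜ).IsPerfectMatching σ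

section JoinedProductGraph

variable {ι : Type*} {U V : ι → Type*}

/-- The edges of the joined product graph. The upper layer consists of the extra node `none`
(called `u`) and the upper nodes of all `G i`, the lower layer of the extra node `none`
(called `v`) and the lower nodes of all `G i`. -/
inductive JPGAdj (G : ∀ i, BipGraph (U i) (V i)) (S : ∀ i, (G i).NodeChoice) :
    Option (Σ i, U i) → Option (Σ i, V i) → Prop
  /-- the edges of the `G i` -/
  | inner {i : ι} {x : U i} {y : V i} (h : (G i).Adj x y) :
      JPGAdj G S (some ⟨i, x⟩) (some ⟨i, y⟩)
  /-- the edge from `u` to the chosen lower node of the last component of `G i` -/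
  | upper (i : ι) : JPGAdj G S none (some ⟨i, (S i).low (Fin.last (S i).last)⟩)
  /-- the edge from `v` to the chosen upper node of the first component of `G i` -/
  | lower (i : ι) : JPGAdj G S (some ⟨i, (S i).up 0⟩) none
  /-- the edge from the chosen lower node of a component of `G i` to the chosen upper node of the
  next component -/
  | link (i : ι) (j : Fin (S i).last) :
      JPGAdj G S (some ⟨i, (S i).up j.succ⟩) (some ⟨i, (S i).low j.castSucc⟩)

/-- The joined product graph. -/
def JPG (G : ∀ i, BipGraph (U i) (V i)) (S : ∀ i, (G i).NodeChoice) :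
    BipGraph (Option (Σ i, U i)) (Option (Σ i, V i)) where
  Adj := JPGAdj G S

/-- The reduced joined product graph: the joined product graph together with the edge between the
two extra nodes. -/
def JPGred (G : ∀ i, BipGraph (U i) (V i)) (S : ∀ i, (G i).NodeChoice) :
    BipGraph (Option (Σ i, U i)) (Option (Σ i, V i)) where
  Adj a b := JPGAdj G S a b ∨ (a = none ∧ b = none)

end JoinedProductGraph

end BipGraph

section JoinedProduct

variable {κ ι : Type*} [DecidableEq κ] [DecidableEq ι]

/-- The Cayley sum of sets `Q i`: the convex hull of the union of the `Q i × {e i}`, with `e i` the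
unit vectors. -/
def cayleySum {E : Type*} [AddCommGroup E] [Module ℝ E] (Q : κ → Set E) : Set (E × (κ → ℝ)) :=
  convexHull ℝ (⋃ i, Q i ×ˢ {(Pi.single i 1 : κ → ℝ)})

/-- The product of the `P j` with the factor number `i` replaced by the zero vector. -/
def omitFactor {E : ι → Type*} [∀ i, AddCommGroup (E i)] (P : ∀ i, Set (E i)) (i : ι) :
    Set (∀ i, E i) :=
  Set.univ.pi (Function.update P i {0})

/-- The joined product `Cayley(Q_1, …, Q_k)`. -/
def joinedProduct {E : ι → Type*} [∀ i, AddCommGroup (E i)] [∀ i, Module ℝ (E i)]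
    (P : ∀ i, Set (E i)) : Set ((∀ i, E i) × (ι → ℝ)) :=
  cayleySum (omitFactor P)

/-- The reduced joined product `Cayley(Q_0, Q_1, …, Q_k)` with `Q_0 = P_1 × ⋯ × P_k`; the index
`none` stands for `0`. -/
def reducedJoinedProduct {E : ι → Type*} [∀ i, AddCommGroup (E i)] [∀ i, Module ℝ (E i)]
    (P : ∀ i, Set (E i)) : Set ((∀ i, E i) × (Option ι → ℝ)) :=
  cayleySum fun o : Option ι => o.elim (Set.univ.pi P) (omitFactor P)

/-- Affine isomorphism of convex sets: an affine map of the ambient spaces restricts to a bijection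
between them. -/
def AffinelyIsomorphic {E F : Type*} [AddCommGroup E] [Module ℝ E] [AddCommGroup F] [Module ℝ F]
    (P : Set E) (Q : Set F) : Prop :=
  ∃ f : E →ᵃ[ℝ] F, Set.BijOn f P Q

end JoinedProduct

/-! A perfect matching of the reduced graph is governed by the partner of the extra node u: either
v, or the last chosen lower node of one block. Inside block i the only edges besides those of G_i
are the links between consecutive components, and only its first chosen upper and last chosen lower
node can be matched outside it.

A perfect matching of G_i shows that both layers of a component are equally large. Hence the chosen
upper node of a component is matched along an edge of G_i iff the chosen lower one is, and each link
passes this property on to the next component. So all components behave alike: the block carries a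
perfect matching of G_i, or all links together with a perfect matching of G_i - S(G_i), which is
unique by pyramidality (`IsLinkedMatching.perfect_or_star`). The second case occurs exactly in the
block attached to u. Perfect matchings thus amount to some `o : Option ι` and a perfect matching of
each block other than `o` (`exists_glue_of_jpgRed_isPerfectMatching`, `exists_equiv_glue`), the same
data as the points spanning the Cayley sum.

The entries on the edges at u give the unit vector of `o` (`apexMap`). As the attached block always
shows the same matrix, subtracting that matrix times the apex entry turns this block into 0 and
leaves the others alone (`blockMap`). The resulting linear map sends the spanning points of one hull
onto those of the other and is injective on a subspace containing the matching matrices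
(`linkedMatrices_ext`). The unreduced graph is the case where `o = none` is excluded. -/

/-- A relation that is functional, injective, total and surjective is the graph of a bijection. -/
theorem exists_equiv_of_rel {A B : Type*} {R : A → B → Prop}
    (hfun : ∀ {x y y'}, R x y → R x y' → y = y') (hinj : ∀ {x x' y}, R x y → R x' y → x = x')
    (htot : ∀ x, ∃ y, R x y) (hsurj : ∀ y, ∃ x, R x y) :
    ∃ e : A ≃ B, ∀ x y, R x y ↔ e x = y := by
  choose f hf using htot
  have hb : Function.Bijective f := by
    refine ⟨fun x x' h => hinj (hf x) (h ▸ hf x'), fun y => ?_⟩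
    obtain ⟨x, hx⟩ := hsurj y
    exact ⟨x, hfun (hf x) hx⟩
  exact ⟨Equiv.ofBijective f hb, fun x y => ⟨fun h => hfun (hf x) h, fun h => h ▸ hf x⟩⟩

/-- On a finite type, a total injective relation is surjective. -/
theorem rel_surjective_of_injective {A : Type*} [Finite A] {R : A → A → Prop}
    (hinj : ∀ {x x' y}, R x y → R x' y → x = x') (htot : ∀ x, ∃ y, R x y) (y : A) :
    ∃ x, R x y := by
  choose f hf using htot
  have hf' : Function.Injective f := fun x x' h => hinj (hf x) (h ▸ hf x')
  obtain ⟨x, hx⟩ := Finite.surjective_of_injective hf' y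
  exact ⟨x, hx ▸ hf x⟩

namespace BipGraph

/-! ### Chosen nodes, links and matchings within one block. -/

section Block

variable {U V : Type*} {G : BipGraph U V}

theorem Adj.mem_supp_iff {x : U} {y : V} (h : G.Adj x y) (C : G.toSimpleGraph.ConnectedComponent) :
    Sum.inl x ∈ C.supp ↔ Sum.inr y ∈ C.supp :=
  C.mem_supp_congr_adj (v := Sum.inl x) (w := Sum.inr y) h

namespace NodeChoice

variable (S : G.NodeChoice)

theorem eq_of_up_mem {i j : Fin (S.last + 1)} (h : Sum.inl (S.up i) ∈ (S.comp j).supp) : i = j :=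
  S.comp.injective ((S.up_mem i).symm.trans h)

theorem eq_of_low_mem {i j : Fin (S.last + 1)} (h : Sum.inr (S.low i) ∈ (S.comp j).supp) :
    i = j :=
  S.comp.injective ((S.low_mem i).symm.trans h)

theorem up_injective : Function.Injective S.up := fun _ j h =>
  S.eq_of_up_mem (h ▸ S.up_mem j)

theorem low_injective : Function.Injective S.low := fun _ j h =>
  S.eq_of_low_mem (h ▸ S.low_mem j)

theorem eq_of_adj {i j : Fin (S.last + 1)} (h : G.Adj (S.up i) (S.low j)) : i = j :=
  (S.eq_of_low_mem ((h.mem_supp_iff _).1 (S.up_mem i))).symm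

/-- The edges that join the chosen lower node of a component to the chosen upper node of the next
component. -/
def Link (x : U) (y : V) : Prop :=
  ∃ j : Fin S.last, x = S.up j.succ ∧ y = S.low j.castSucc

/-- The matching that consists of all linking edges and a matching of the nodes that are not
chosen. -/
def Star (ρ : ↥(Set.range S.up)ᶜ ≃ ↥(Set.range S.low)ᶜ) (x : U) (y : V) : Prop :=
  S.Link x y ∨ ∃ hx hy, ρ ⟨x, hx⟩ = ⟨y, hy⟩

variable {S}

theorem Link.right_unique {x : U} {y y' : V} (h : S.Link x y) (h' : S.Link x y') : y = y' := by
  obtain ⟨j, rfl, rfl⟩ := h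
  obtain ⟨j', e, rfl⟩ := h'
  rw [Fin.succ_injective _ (S.up_injective e)]

theorem Link.left_unique {x x' : U} {y : V} (h : S.Link x y) (h' : S.Link x' y) : x = x' := by
  obtain ⟨j, rfl, rfl⟩ := h
  obtain ⟨j', rfl, e⟩ := h'
  rw [Fin.castSucc_injective _ (S.low_injective e)]

/-- A link joins different components, so "edge of `G`" and "link" exclude each other. -/
theorem Link.not_adj {x : U} {y : V} (h : S.Link x y) : ¬ G.Adj x y := by
  obtain ⟨j, rfl, rfl⟩ := h
  exact fun h => (Fin.castSucc_lt_succ (i := j)).ne' (S.eq_of_adj h)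

theorem Link.up_mem {x : U} {y : V} (h : S.Link x y) : x ∈ Set.range S.up := by
  obtain ⟨j, rfl, rfl⟩ := h
  exact ⟨_, rfl⟩

theorem Link.low_mem {x : U} {y : V} (h : S.Link x y) : y ∈ Set.range S.low := by
  obtain ⟨j, rfl, rfl⟩ := h
  exact ⟨_, rfl⟩

variable {ρ : ↥(Set.range S.up)ᶜ ≃ ↥(Set.range S.low)ᶜ}

theorem Star.right_unique {x : U} {y y' : V} (h : S.Star ρ x y) (h' : S.Star ρ x y') :
    y = y' := by
  rcases h with h | ⟨hx, hy, h⟩ <;> rcases h' with h' | ⟨hx', hy', h'⟩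
  · exact h.right_unique h'
  · exact (hx' h.up_mem).elim
  · exact (hx h'.up_mem).elim
  · exact congrArg Subtype.val (h.symm.trans h')

theorem Star.left_unique {x x' : U} {y : V} (h : S.Star ρ x y) (h' : S.Star ρ x' y) :
    x = x' := by
  rcases h with h | ⟨hx, hy, h⟩ <;> rcases h' with h' | ⟨hx', hy', h'⟩
  · exact h.left_unique h'
  · exact (hy' h.low_mem).elim
  · exact (hy h'.low_mem).elim
  · exact congrArg Subtype.val (ρ.injective (h.trans h'.symm))

/-- Links start at the second component on the upper side, which keeps this node free for the extra
node v. -/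
theorem not_star_up_zero (y : V) : ¬ S.Star ρ (S.up 0) y := by
  rintro (⟨j, hj, -⟩ | ⟨hx, -, -⟩)
  · exact Fin.succ_ne_zero j (S.up_injective hj).symm
  · exact hx ⟨_, rfl⟩

theorem not_star_low_last (x : U) : ¬ S.Star ρ x (S.low (Fin.last S.last)) := by
  rintro (⟨j, -, hj⟩ | ⟨-, hy, -⟩)
  · exact (Fin.castSucc_lt_last j).ne (S.low_injective hj).symm
  · exact hy ⟨_, rfl⟩

theorem exists_star_of_ne {x : U} (h : x ≠ S.up 0) : ∃ y, S.Star ρ x y := by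
  by_cases hx : x ∈ Set.range S.up
  · obtain ⟨j, rfl⟩ := hx
    obtain ⟨j, rfl⟩ := Fin.exists_succ_eq.2 (fun h' : j = 0 => h (h' ▸ rfl))
    exact ⟨_, Or.inl ⟨j, rfl, rfl⟩⟩
  · exact ⟨ρ ⟨x, hx⟩, Or.inr ⟨hx, (ρ ⟨x, hx⟩).2, rfl⟩⟩

theorem exists_star_of_ne' {y : V} (h : y ≠ S.low (Fin.last S.last)) : ∃ x, S.Star ρ x y := by
  by_cases hy : y ∈ Set.range S.low
  · obtain ⟨j, rfl⟩ := hy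
    obtain ⟨j, rfl⟩ := Fin.exists_castSucc_eq.2 (fun h' : j = Fin.last _ => h (h' ▸ rfl))
    exact ⟨_, Or.inl ⟨j, rfl, rfl⟩⟩
  · exact ⟨ρ.symm ⟨y, hy⟩, Or.inr ⟨(ρ.symm ⟨y, hy⟩).2, hy, by simp⟩⟩

end NodeChoice

/-! ### The all-or-nothing principle for linked matchings. -/

/-- A partial matching of a bipartite graph with the linking edges of a choice of nodes, that may
leave out only the chosen upper node of the first and the chosen lower node of the last
component. -/
structure IsLinkedMatching (S : G.NodeChoice) (R : U → V → Prop) : Prop where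
  right_unique : ∀ {x y y'}, R x y → R x y' → y = y'
  left_unique : ∀ {x x' y}, R x y → R x' y → x = x'
  adj_or_link : ∀ {x y}, R x y → G.Adj x y ∨ S.Link x y
  exists_right : ∀ {x}, x ≠ S.up 0 → ∃ y, R x y
  exists_left : ∀ {y}, y ≠ S.low (Fin.last S.last) → ∃ x, R x y

namespace IsLinkedMatching

variable {S : G.NodeChoice} {R : U → V → Prop}

theorem exists_adj_of_notMem (h : IsLinkedMatching S R) {x : U} (hx : x ∉ Set.range S.up) :
    ∃ y, R x y ∧ G.Adj x y := by
  obtain ⟨y, hy⟩ := h.exists_right (x := x) (fun e => hx ⟨_, e.symm⟩)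
  exact ⟨y, hy, (h.adj_or_link hy).resolve_right fun hl => hx hl.up_mem⟩

theorem exists_adj_of_notMem' (h : IsLinkedMatching S R) {y : V} (hy : y ∉ Set.range S.low) :
    ∃ x, R x y ∧ G.Adj x y := by
  obtain ⟨x, hx⟩ := h.exists_left (y := y) (fun e => hy ⟨_, e.symm⟩)
  exact ⟨x, hx, (h.adj_or_link hx).resolve_right fun hl => hy hl.low_mem⟩

/-- Within a component, the chosen upper node is matched if and only if the chosen lower node is,
as both layers of the component have the same number of nodes. -/
theorem up_matched_iff_low_matched [Finite U] (hG : ∃ σ : U ≃ V, G.IsPerfectMatching σ)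
    (h : IsLinkedMatching S R) (j : Fin (S.last + 1)) :
    (∃ y, R (S.up j) y ∧ G.Adj (S.up j) y) ↔ ∃ x, R x (S.low j) ∧ G.Adj x (S.low j) := by
  obtain ⟨σ, hσ⟩ := hG
  let A := {x : U // Sum.inl x ∈ (S.comp j).supp}
  -- Pulling lower nodes back along `σ`, which preserves components, makes `R` a relation on one
  -- finite set, so that injective and total imply surjective.
  let T : A → A → Prop := fun x z => R x.1 (σ z.1) ∧ G.Adj x.1 (σ z.1)
  have hT1 : ∀ {x x' z : A}, T x z → T x' z → x = x' := fun h1 h2 =>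
    Subtype.ext (h.left_unique h1.1 h2.1)
  have hT2 : ∀ {x z z' : A}, T x z → T x z' → z = z' := fun h1 h2 =>
    Subtype.ext (σ.injective (h.right_unique h1.1 h2.1))
  have hlow : Sum.inl (σ.symm (S.low j)) ∈ (S.comp j).supp := by
    have := hσ (σ.symm (S.low j))
    rw [σ.apply_symm_apply] at this
    exact (this.mem_supp_iff _).2 (S.low_mem j)
  constructor
  · intro hup
    obtain ⟨x, hx⟩ := rel_surjective_of_injective (R := T) hT1 (fun x => by
      obtain ⟨y, hy, hxy⟩ : ∃ y, R x.1 y ∧ G.Adj x.1 y := by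
        by_cases hx : x.1 ∈ Set.range S.up
        · obtain ⟨i, hi⟩ := hx
          have : i = j := S.eq_of_up_mem (hi ▸ x.2)
          rwa [← hi, this]
        · exact h.exists_adj_of_notMem hx
      refine ⟨⟨σ.symm y, ((hσ _).mem_supp_iff _).2 ?_⟩, ?_⟩
      · rw [σ.apply_symm_apply]
        exact (hxy.mem_supp_iff _).1 x.2
      · change R x.1 (σ (σ.symm y)) ∧ G.Adj x.1 (σ (σ.symm y))
        rw [σ.apply_symm_apply]
        exact ⟨hy, hxy⟩) ⟨_, hlow⟩
    change R x.1 (σ (σ.symm (S.low j))) ∧ G.Adj x.1 (σ (σ.symm (S.low j))) at hx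
    rw [σ.apply_symm_apply] at hx
    exact ⟨x.1, hx⟩
  · intro hl
    obtain ⟨x, hx⟩ := rel_surjective_of_injective (R := fun z x => T x z) hT2 (fun z => by
      obtain ⟨x, hx, hxy⟩ : ∃ x, R x (σ z.1) ∧ G.Adj x (σ z.1) := by
        by_cases hz : σ z.1 ∈ Set.range S.low
        · obtain ⟨i, hi⟩ := hz
          have : i = j := S.eq_of_low_mem (hi ▸ ((hσ _).mem_supp_iff _).1 z.2)
          rwa [← hi, this]
        · exact h.exists_adj_of_notMem' hz
      exact ⟨⟨x, (hxy.mem_supp_iff _).2 (((hσ _).mem_supp_iff _).1 z.2)⟩, hx, hxy⟩)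
      ⟨_, S.up_mem j⟩
    exact ⟨_, hx⟩

/-- Both ends of a link must be covered, and the link is the only edge outside `G` at either end. If
one end is covered by an edge of `G`, the link is unused and the other end needs an edge of `G` too.
-/
theorem low_castSucc_matched_iff (h : IsLinkedMatching S R) (j : Fin S.last) :
    (∃ x, R x (S.low j.castSucc) ∧ G.Adj x (S.low j.castSucc)) ↔
      ∃ y, R (S.up j.succ) y ∧ G.Adj (S.up j.succ) y := by
  have hlink : S.Link (S.up j.succ) (S.low j.castSucc) := ⟨j, rfl, rfl⟩
  constructor
  · rintro ⟨x, hx, hxy⟩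
    obtain ⟨y, hy⟩ := h.exists_right (x := S.up j.succ)
      (fun e => Fin.succ_ne_zero j (S.up_injective e))
    refine ⟨y, hy, (h.adj_or_link hy).resolve_right fun hl => hlink.not_adj ?_⟩
    rw [hl.right_unique hlink] at hy
    rwa [h.left_unique hy hx]
  · rintro ⟨y, hy, hxy⟩
    obtain ⟨x, hx⟩ := h.exists_left (y := S.low j.castSucc)
      (fun e => (Fin.castSucc_lt_last j).ne (S.low_injective e))
    refine ⟨x, hx, (h.adj_or_link hx).resolve_right fun hl => hlink.not_adj ?_⟩
    rw [hl.left_unique hlink] at hx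
    rwa [h.right_unique hx hy]

theorem up_matched_iff_zero [Finite U] (hG : ∃ σ : U ≃ V, G.IsPerfectMatching σ)
    (h : IsLinkedMatching S R) (j : Fin (S.last + 1)) :
    (∃ y, R (S.up j) y ∧ G.Adj (S.up j) y) ↔ ∃ y, R (S.up 0) y ∧ G.Adj (S.up 0) y := by
  induction j using Fin.induction with
  | zero => rfl
  | succ j ih =>
    rw [← ih, h.up_matched_iff_low_matched hG j.castSucc, h.low_castSucc_matched_iff]

/-- A linked matching is either a perfect matching of the graph, or it consists of all linking
edges and the perfect matching of the remaining nodes. -/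
theorem perfect_or_star [Finite U] (hG : ∃ σ : U ≃ V, G.IsPerfectMatching σ)
    {ρ : ↥(Set.range S.up)ᶜ ≃ ↥(Set.range S.low)ᶜ}
    (hρ : ∀ ρ' : ↥(Set.range S.up)ᶜ ≃ ↥(Set.range S.low)ᶜ,
      (G.induce (Set.range S.up)ᶜ (Set.range S.low)ᶜ).IsPerfectMatching ρ' → ρ' = ρ)
    (h : IsLinkedMatching S R) :
    (∃ σ : U ≃ V, G.IsPerfectMatching σ ∧ ∀ x y, R x y ↔ σ x = y) ∨
      ∀ x y, R x y ↔ S.Star ρ x y := by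
  have key := h.up_matched_iff_zero hG
  have key' := h.up_matched_iff_low_matched hG
  by_cases h0 : ∃ y, R (S.up 0) y ∧ G.Adj (S.up 0) y
  · left
    have hx : ∀ x, ∃ y, R x y ∧ G.Adj x y := fun x => by
      by_cases hx : x ∈ Set.range S.up
      · obtain ⟨j, rfl⟩ := hx
        exact (key j).2 h0
      · exact h.exists_adj_of_notMem hx
    have hy : ∀ y, ∃ x, R x y ∧ G.Adj x y := fun y => by
      by_cases hy : y ∈ Set.range S.low
      · obtain ⟨j, rfl⟩ := hy
        exact (key' j).1 ((key j).2 h0)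
      · exact h.exists_adj_of_notMem' hy
    obtain ⟨σ, hσ⟩ := exists_equiv_of_rel (R := R) h.right_unique h.left_unique
      (fun x => (hx x).imp fun _ => And.left) (fun y => (hy y).imp fun _ => And.left)
    refine ⟨σ, fun x => ?_, hσ⟩
    obtain ⟨y, hy, hxy⟩ := hx x
    rwa [(hσ x y).1 hy]
  · right
    have hup : ∀ {j y}, R (S.up j) y → ¬ G.Adj (S.up j) y := fun {j y} hy hxy =>
      h0 ((key j).1 ⟨y, hy, hxy⟩)
    have hlow : ∀ {j x}, R x (S.low j) → ¬ G.Adj x (S.low j) := fun {j x} hx hxy =>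
      h0 ((key j).1 ((key' j).2 ⟨x, hx, hxy⟩))
    -- No chosen node is covered by an edge of `G`, so the unchosen nodes are matched among
    -- themselves and uniqueness applies.
    obtain ⟨ρ', hρ'⟩ := exists_equiv_of_rel (A := ↥(Set.range S.up)ᶜ) (B := ↥(Set.range S.low)ᶜ)
      (R := fun x y => R x y) (fun h1 h2 => Subtype.ext (h.right_unique h1 h2))
      (fun h1 h2 => Subtype.ext (h.left_unique h1 h2))
      (fun x => by
        obtain ⟨y, hy, hxy⟩ := h.exists_adj_of_notMem x.2
        refine ⟨⟨y, ?_⟩, hy⟩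
        rintro ⟨j, rfl⟩
        exact hlow hy hxy)
      (fun y => by
        obtain ⟨x, hx, hxy⟩ := h.exists_adj_of_notMem' y.2
        refine ⟨⟨x, ?_⟩, hx⟩
        rintro ⟨j, rfl⟩
        exact hup hx hxy)
    have hρρ : ρ' = ρ := hρ ρ' fun x =>
      (h.adj_or_link ((hρ' x _).2 rfl)).resolve_right fun hl => x.2 hl.up_mem
    subst hρρ
    have hRS : ∀ {x y}, R x y → S.Star ρ' x y := fun {x y} hxy => by
      rcases h.adj_or_link hxy with ha | hl
      · have hx : x ∉ Set.range S.up := by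
          rintro ⟨j, rfl⟩
          exact hup hxy ha
        have hy : y ∉ Set.range S.low := by
          rintro ⟨j, rfl⟩
          exact hlow hxy ha
        exact Or.inr ⟨hx, hy, (hρ' ⟨x, hx⟩ ⟨y, hy⟩).1 hxy⟩
      · exact Or.inl hl
    -- Conversely, a star edge does not start at `S.up 0`, so `R` has an edge at `x`; that edge is a
    -- star edge too, hence the same one.
    refine fun x y => ⟨hRS, fun hs => ?_⟩
    obtain ⟨y', hy'⟩ := h.exists_right (x := x) (fun e => NodeChoice.not_star_up_zero y (e ▸ hs))
    rwa [hs.right_unique (hRS hy')]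

end IsLinkedMatching

end Block

end BipGraph

namespace BipGraph

/-! ### Assembling and decomposing perfect matchings of the joined product graphs. -/

section Glue

variable {ι : Type*} {U V : ι → Type*} {G : ∀ i, BipGraph (U i) (V i)}

/-- The edge set formed from edge sets `R i` of the blocks, the edge between the two extra nodes if
`o = none`, and the edges from the extra nodes to block number `i` if `o = some i`. -/
inductive Glue (S : ∀ i, (G i).NodeChoice) (o : Option ι) (R : ∀ i, U i → V i → Prop) :
    Option (Σ i, U i) → Option (Σ i, V i) → Prop
  | inner {i : ι} {x : U i} {y : V i} (h : R i x y) : Glue S o R (some ⟨i, x⟩) (some ⟨i, y⟩)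
  | upper {i : ι} (h : o = some i) : Glue S o R none (some ⟨i, (S i).low (Fin.last (S i).last)⟩)
  | lower {i : ι} (h : o = some i) : Glue S o R (some ⟨i, (S i).up 0⟩) none
  | base (h : o = none) : Glue S o R none none

variable {S : ∀ i, (G i).NodeChoice} {o : Option ι} {R : ∀ i, U i → V i → Prop}

theorem glue_none_none : Glue S o R none none ↔ o = none :=
  ⟨fun | .base h => h, .base⟩

theorem glue_none_some {i : ι} {y : V i} :
    Glue S o R none (some ⟨i, y⟩) ↔ o = some i ∧ y = (S i).low (Fin.last (S i).last) :=
  ⟨fun | .upper h => ⟨h, rfl⟩, by rintro ⟨h, rfl⟩; exact .upper h⟩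

theorem glue_some_none {i : ι} {x : U i} :
    Glue S o R (some ⟨i, x⟩) none ↔ o = some i ∧ x = (S i).up 0 :=
  ⟨fun | .lower h => ⟨h, rfl⟩, by rintro ⟨h, rfl⟩; exact .lower h⟩

theorem glue_some_some {i : ι} {x : U i} {y : V i} :
    Glue S o R (some ⟨i, x⟩) (some ⟨i, y⟩) ↔ R i x y :=
  ⟨fun | .inner h => h, .inner⟩

theorem Glue.fst_eq {i i' : ι} {x : U i} {y : V i'}
    (h : Glue S o R (some ⟨i, x⟩) (some ⟨i', y⟩)) : i = i' := by
  cases h; rfl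

/-- The edge sets of the blocks of a perfect matching of a joined product graph: block number `i`
uses the linking edges if `o = some i`. -/
def blockRel (S : ∀ i, (G i).NodeChoice)
    (ρ : ∀ i, ↥(Set.range (S i).up)ᶜ ≃ ↥(Set.range (S i).low)ᶜ) (o : Option ι)
    (σ : ∀ i, U i ≃ V i) (i : ι) (x : U i) (y : V i) : Prop :=
  (o = some i ∧ (S i).Star (ρ i) x y) ∨ (o ≠ some i ∧ σ i x = y)

variable {ρ : ∀ i, ↥(Set.range (S i).up)ᶜ ≃ ↥(Set.range (S i).low)ᶜ} {σ : ∀ i, U i ≃ V i}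

theorem blockRel_of_eq {i : ι} (h : o = some i) {x : U i} {y : V i} :
    blockRel S ρ o σ i x y ↔ (S i).Star (ρ i) x y := by simp [blockRel, h]

theorem blockRel_of_ne {i : ι} (h : o ≠ some i) {x : U i} {y : V i} :
    blockRel S ρ o σ i x y ↔ σ i x = y := by simp [blockRel, h]

theorem blockRel_right_unique {i : ι} {x : U i} {y y' : V i} (h : blockRel S ρ o σ i x y)
    (h' : blockRel S ρ o σ i x y') : y = y' := by
  by_cases ho : o = some i
  · rw [blockRel_of_eq ho] at h h'
    exact h.right_unique h'
  · rw [blockRel_of_ne ho] at h h'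
    exact h.symm.trans h'

theorem blockRel_left_unique {i : ι} {x x' : U i} {y : V i} (h : blockRel S ρ o σ i x y)
    (h' : blockRel S ρ o σ i x' y) : x = x' := by
  by_cases ho : o = some i
  · rw [blockRel_of_eq ho] at h h'
    exact h.left_unique h'
  · rw [blockRel_of_ne ho] at h h'
    exact (σ i).injective (h.trans h'.symm)

theorem glue_blockRel_right_unique {a b b'} (h : Glue S o (blockRel S ρ o σ) a b)
    (h' : Glue S o (blockRel S ρ o σ) a b') : b = b' := by
  rcases h with @⟨i, x, y, h⟩ | @⟨i, h⟩ | @⟨i, h⟩ | h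
  · rcases b' with _ | ⟨i', y'⟩
    · obtain ⟨h1, rfl⟩ := glue_some_none.1 h'
      exact (NodeChoice.not_star_up_zero y ((blockRel_of_eq h1).1 h)).elim
    · obtain rfl := h'.fst_eq
      rw [blockRel_right_unique h (glue_some_some.1 h')]
  · rcases b' with _ | ⟨i', y'⟩
    · simp [glue_none_none.1 h'] at h
    · obtain ⟨h1, rfl⟩ := glue_none_some.1 h'
      obtain rfl : i = i' := Option.some_injective _ (h.symm.trans h1)
      rfl
  · rcases b' with _ | ⟨i', y'⟩
    · rfl
    · obtain rfl := h'.fst_eq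
      exact (NodeChoice.not_star_up_zero y' ((blockRel_of_eq h).1 (glue_some_some.1 h'))).elim
  · rcases b' with _ | ⟨i', y'⟩
    · rfl
    · simp [(glue_none_some.1 h').1] at h

theorem glue_blockRel_left_unique {a a' b} (h : Glue S o (blockRel S ρ o σ) a b)
    (h' : Glue S o (blockRel S ρ o σ) a' b) : a = a' := by
  rcases h with @⟨i, x, y, h⟩ | @⟨i, h⟩ | @⟨i, h⟩ | h
  · rcases a' with _ | ⟨i', x'⟩
    · obtain ⟨h1, rfl⟩ := glue_none_some.1 h'
      exact (NodeChoice.not_star_low_last x ((blockRel_of_eq h1).1 h)).elim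
    · obtain rfl := h'.fst_eq
      rw [blockRel_left_unique h (glue_some_some.1 h')]
  · rcases a' with _ | ⟨i', x'⟩
    · rfl
    · obtain rfl := h'.fst_eq
      exact (NodeChoice.not_star_low_last x' ((blockRel_of_eq h).1 (glue_some_some.1 h'))).elim
  · rcases a' with _ | ⟨i', x'⟩
    · simp [glue_none_none.1 h'] at h
    · obtain ⟨h1, rfl⟩ := glue_some_none.1 h'
      obtain rfl : i = i' := Option.some_injective _ (h.symm.trans h1)
      rfl
  · rcases a' with _ | ⟨i', x'⟩
    · rfl
    · simp [(glue_some_none.1 h').1] at h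

theorem exists_glue_blockRel_right (a) : ∃ b, Glue S o (blockRel S ρ o σ) a b := by
  rcases a with _ | ⟨i, x⟩
  · rcases ho : o with _ | i
    · exact ⟨none, .base rfl⟩
    · exact ⟨_, .upper rfl⟩
  · by_cases ho : o = some i
    · by_cases hx : x = (S i).up 0
      · exact ⟨none, glue_some_none.2 ⟨ho, hx⟩⟩
      · obtain ⟨y, hy⟩ := NodeChoice.exists_star_of_ne (ρ := ρ i) hx
        exact ⟨_, .inner ((blockRel_of_eq ho).2 hy)⟩
    · exact ⟨_, .inner ((blockRel_of_ne ho).2 rfl)⟩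

theorem exists_glue_blockRel_left (b) : ∃ a, Glue S o (blockRel S ρ o σ) a b := by
  rcases b with _ | ⟨i, y⟩
  · rcases ho : o with _ | i
    · exact ⟨none, .base rfl⟩
    · exact ⟨_, .lower rfl⟩
  · by_cases ho : o = some i
    · by_cases hy : y = (S i).low (Fin.last (S i).last)
      · exact ⟨none, glue_none_some.2 ⟨ho, hy⟩⟩
      · obtain ⟨x, hx⟩ := NodeChoice.exists_star_of_ne' (ρ := ρ i) hy
        exact ⟨_, .inner ((blockRel_of_eq ho).2 hx)⟩
    · exact ⟨_, .inner ((blockRel_of_ne ho).2 ((σ i).apply_symm_apply y))⟩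

/-- The star in block `o` misses exactly its first chosen upper and last chosen lower node, and
these are the partners of the extra nodes. -/
theorem exists_equiv_glue (S : ∀ i, (G i).NodeChoice)
    (ρ : ∀ i, ↥(Set.range (S i).up)ᶜ ≃ ↥(Set.range (S i).low)ᶜ) (o : Option ι)
    (σ : ∀ i, U i ≃ V i) :
    ∃ τ : Option (Σ i, U i) ≃ Option (Σ i, V i),
      ∀ a b, Glue S o (blockRel S ρ o σ) a b ↔ τ a = b :=
  exists_equiv_of_rel glue_blockRel_right_unique glue_blockRel_left_unique
    exists_glue_blockRel_right exists_glue_blockRel_left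

theorem jpgRed_adj_of_glue
    (hρ : ∀ i, ((G i).induce (Set.range (S i).up)ᶜ (Set.range (S i).low)ᶜ).IsPerfectMatching (ρ i))
    (hσ : ∀ i, (G i).IsPerfectMatching (σ i)) {a b} (h : Glue S o (blockRel S ρ o σ) a b) :
    (JPGred G S).Adj a b := by
  rcases h with @⟨i, x, y, h⟩ | @⟨i, h⟩ | @⟨i, h⟩ | h
  · left
    by_cases ho : o = some i
    · rcases (blockRel_of_eq ho).1 h with ⟨j, rfl, rfl⟩ | ⟨hx, hy, h⟩
      · exact .link i j
      · have := hρ i ⟨x, hx⟩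
        rw [h] at this
        exact .inner this
    · obtain rfl := (blockRel_of_ne ho).1 h
      exact .inner (hσ i x)
  · exact .inl (.upper i)
  · exact .inl (.lower i)
  · exact .inr ⟨rfl, rfl⟩

theorem jpgRed_isPerfectMatching_of_glue
    (hρ : ∀ i, ((G i).induce (Set.range (S i).up)ᶜ (Set.range (S i).low)ᶜ).IsPerfectMatching (ρ i))
    (hσ : ∀ i, (G i).IsPerfectMatching (σ i)) {τ : Option (Σ i, U i) ≃ Option (Σ i, V i)}
    (h : ∀ a b, Glue S o (blockRel S ρ o σ) a b ↔ τ a = b) :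
    (JPGred G S).IsPerfectMatching τ := fun a =>
  jpgRed_adj_of_glue hρ hσ ((h a _).2 rfl)

theorem jpg_isPerfectMatching_iff {τ : Option (Σ i, U i) ≃ Option (Σ i, V i)} :
    (JPG G S).IsPerfectMatching τ ↔ (JPGred G S).IsPerfectMatching τ ∧ τ none ≠ none := by
  constructor
  · refine fun h => ⟨fun a => .inl (h a), fun h' => ?_⟩
    have := h none
    rw [h'] at this
    cases this
  · rintro ⟨h, h'⟩ a
    exact (h a).resolve_right fun ⟨h1, h2⟩ => h' (h1 ▸ h2)

theorem eq_of_jpgRed_adj_none_some {i : ι} {y : V i}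
    (h : (JPGred G S).Adj none (some ⟨i, y⟩)) : y = (S i).low (Fin.last (S i).last) := by
  rcases h with h | ⟨-, h⟩
  · cases h; rfl
  · cases h

theorem eq_of_jpgRed_adj_some_none {i : ι} {x : U i}
    (h : (JPGred G S).Adj (some ⟨i, x⟩) none) : x = (S i).up 0 := by
  rcases h with h | ⟨h, -⟩
  · cases h; rfl
  · cases h

theorem fst_eq_of_jpgRed_adj {i i' : ι} {x : U i} {y : V i'}
    (h : (JPGred G S).Adj (some ⟨i, x⟩) (some ⟨i', y⟩)) : i = i' := by
  rcases h with h | ⟨h, -⟩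
  · cases h <;> rfl
  · cases h

theorem jpgRed_adj_some_some {i : ι} {x : U i} {y : V i}
    (h : (JPGred G S).Adj (some ⟨i, x⟩) (some ⟨i, y⟩)) : (G i).Adj x y ∨ (S i).Link x y := by
  rcases h with h | ⟨h, -⟩
  · cases h with
    | inner h => exact .inl h
    | link i j => exact .inr ⟨j, rfl, rfl⟩
  · cases h

/-- Edges leave a block only towards the extra nodes, and only from its first chosen upper and last
chosen lower node. -/
theorem isLinkedMatching_of_jpgRed {τ : Option (Σ i, U i) ≃ Option (Σ i, V i)}
    (hτ : (JPGred G S).IsPerfectMatching τ) (i : ι) :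
    IsLinkedMatching (S i) fun x y => τ (some ⟨i, x⟩) = some ⟨i, y⟩ where
  right_unique h h' := by simpa using h.symm.trans h'
  left_unique h h' := by simpa using τ.injective (h.trans h'.symm)
  adj_or_link {x y} h := jpgRed_adj_some_some (h ▸ hτ _)
  exists_right {x} hx := by
    have := hτ (some ⟨i, x⟩)
    rcases h : τ (some ⟨i, x⟩) with _ | ⟨i', y⟩
    · rw [h] at this
      exact (hx (eq_of_jpgRed_adj_some_none this)).elim
    · rw [h] at this
      obtain rfl := fst_eq_of_jpgRed_adj this
      exact ⟨y, rfl⟩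
  exists_left {y} hy := by
    have := hτ (τ.symm (some ⟨i, y⟩))
    rw [τ.apply_symm_apply] at this
    rcases h : τ.symm (some ⟨i, y⟩) with _ | ⟨i', x⟩
    · rw [h] at this
      exact (hy (eq_of_jpgRed_adj_none_some this)).elim
    · rw [h] at this
      obtain rfl := fst_eq_of_jpgRed_adj this
      exact ⟨x, (τ.symm_apply_eq.1 h).symm⟩

/-- The perfect matchings of the reduced joined product graph. -/
theorem exists_glue_of_jpgRed_isPerfectMatching [∀ i, Finite (U i)]
    (hG : ∀ i, ∃ σ : U i ≃ V i, (G i).IsPerfectMatching σ)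
    (hρ : ∀ i, ∀ ρ' : ↥(Set.range (S i).up)ᶜ ≃ ↥(Set.range (S i).low)ᶜ,
      ((G i).induce (Set.range (S i).up)ᶜ (Set.range (S i).low)ᶜ).IsPerfectMatching ρ' → ρ' = ρ i)
    {τ : Option (Σ i, U i) ≃ Option (Σ i, V i)} (hτ : (JPGred G S).IsPerfectMatching τ) :
    ∃ (o : Option ι) (σ : ∀ i, U i ≃ V i), (∀ i, (G i).IsPerfectMatching (σ i)) ∧
      ∀ a b, Glue S o (blockRel S ρ o σ) a b ↔ τ a = b := by
  let o : Option ι := (τ none).map Sigma.fst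
  have hlast : ∀ {i}, o = some i → τ none = some ⟨i, (S i).low (Fin.last (S i).last)⟩ := by
    intro i ho
    have := hτ none
    rcases h : τ none with _ | ⟨i', y⟩
    · simp [o, h] at ho
    · obtain rfl : i' = i := by simpa [o, h] using ho
      rw [h] at this
      rw [eq_of_jpgRed_adj_none_some this]
  have hblock : ∀ i, ∃ σ : U i ≃ V i, (G i).IsPerfectMatching σ ∧
      (o ≠ some i → ∀ x y, τ (some ⟨i, x⟩) = some ⟨i, y⟩ ↔ σ x = y) ∧
      (o = some i → ∀ x y, τ (some ⟨i, x⟩) = some ⟨i, y⟩ ↔ (S i).Star (ρ i) x y) := by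
    intro i
    rcases (isLinkedMatching_of_jpgRed hτ i).perfect_or_star (hG i) (hρ i) with
      ⟨σ, hσ, h⟩ | h
    -- A perfect matching of the block covers its last chosen lower node, which is therefore not the
    -- partner of u.
    · refine ⟨σ, hσ, fun _ => h, fun ho => ?_⟩
      have := ((h _ _).2 (σ.apply_symm_apply _)).trans (hlast ho).symm
      simpa using τ.injective this
    · obtain ⟨σ, hσ⟩ := hG i
      refine ⟨σ, hσ, fun ho => ?_, fun _ => h⟩
      have hl := hτ (τ.symm (some ⟨i, (S i).low (Fin.last (S i).last)⟩))
      rw [τ.apply_symm_apply] at hl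
      rcases hx : τ.symm (some ⟨i, (S i).low (Fin.last (S i).last)⟩) with _ | ⟨i', x⟩
      · exact (ho (by simp [o, ← τ.symm_apply_eq.1 hx])).elim
      · rw [hx] at hl
        obtain rfl := fst_eq_of_jpgRed_adj hl
        exact (NodeChoice.not_star_low_last x ((h _ _).1 (τ.symm_apply_eq.1 hx).symm)).elim
  choose σ hσ h1 h2 using hblock
  refine ⟨o, σ, hσ, ?_⟩
  obtain ⟨τ', hτ'⟩ := exists_equiv_glue S ρ o σ
  have hin : ∀ i x y, Glue S o (blockRel S ρ o σ) (some ⟨i, x⟩) (some ⟨i, y⟩) ↔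
      τ (some ⟨i, x⟩) = some ⟨i, y⟩ := by
    intro i x y
    rw [glue_some_some]
    by_cases ho : o = some i
    · rw [blockRel_of_eq ho, h2 i ho]
    · rw [blockRel_of_ne ho, h1 i ho]
  have hnone : τ' none = τ none := by
    rw [← hτ']
    rcases ho : o with _ | i
    · have : τ none = none := by simpa [o] using ho
      rw [this]
      exact .base rfl
    · rw [hlast ho]
      exact .upper rfl
  have : τ' = τ := by
    ext1 a
    rcases a with _ | ⟨i, x⟩
    · exact hnone
    -- Within blocks `hin` makes the two matchings agree, so one of them maps the node to v only if
    -- the other does.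
    · rcases hb : τ (some ⟨i, x⟩) with _ | ⟨i', y⟩
      · rcases hb' : τ' (some ⟨i, x⟩) with _ | ⟨i', y⟩
        · rfl
        · have hg := (hτ' _ _).2 hb'
          obtain rfl := hg.fst_eq
          rw [hin, hb] at hg
          cases hg
      · have : i = i' := fst_eq_of_jpgRed_adj (S := S) (hb ▸ hτ _)
        subst this
        rw [← hτ', hin, hb]
  exact this ▸ hτ'

theorem exists_jpgRed_isPerfectMatching_of_glue
    (hρ : ∀ i, ((G i).induce (Set.range (S i).up)ᶜ (Set.range (S i).low)ᶜ).IsPerfectMatching (ρ i))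
    (hσ : ∀ i, (G i).IsPerfectMatching (σ i)) {a b} (h : Glue S o (blockRel S ρ o σ) a b) :
    ∃ τ, (JPGred G S).IsPerfectMatching τ ∧ τ a = b ∧ (τ none = none ↔ o = none) := by
  obtain ⟨τ, hτ⟩ := exists_equiv_glue S ρ o σ
  exact ⟨τ, jpgRed_isPerfectMatching_of_glue hρ hσ hτ, (hτ _ _).1 h,
    (hτ _ _).symm.trans glue_none_none⟩

/-! ### Every edge lies in a perfect matching. -/

variable [Nontrivial ι]

theorem jpg_isFaceGraph (hG : ∀ i, (G i).IsFaceGraph) (hS : ∀ i, (S i).IsPyramidal) :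
    (JPG G S).IsFaceGraph := by
  classical
  choose σ hσ using fun i => (hG i).1
  choose ρ hρ using fun i => (hS i).exists
  have key : ∀ {a b} {i : ι} {σ : ∀ i, U i ≃ V i}, (∀ i, (G i).IsPerfectMatching (σ i)) →
      Glue S (some i) (blockRel S ρ (some i) σ) a b →
      ∃ τ, (JPG G S).IsPerfectMatching τ ∧ τ a = b := by
    intro a b i σ hσ h
    obtain ⟨τ, hτ, h1, h2⟩ := exists_jpgRed_isPerfectMatching_of_glue hρ hσ h
    exact ⟨τ, jpg_isPerfectMatching_iff.2 ⟨hτ, fun h => by simpa using h2.1 h⟩, h1⟩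
  refine ⟨?_, fun a b h => ?_⟩
  · obtain ⟨i⟩ : Nonempty ι := inferInstance
    obtain ⟨τ, hτ, -⟩ := key hσ (.upper (i := i) rfl)
    exact ⟨τ, hτ⟩
  · rcases h with @⟨i, x, y, h⟩ | i | i | ⟨i, j⟩
    -- For an edge of `G i`, block `i` must carry a perfect matching of its own, so the extra nodes
    -- are attached to another block; this is where two blocks are needed.
    · obtain ⟨i', hi'⟩ := exists_ne i
      obtain ⟨σi, hσi, hxy⟩ := (hG i).2 x y h
      refine key (i := i') (σ := Function.update σ i σi) (fun l => ?_)
        (.inner ((blockRel_of_ne (by simpa using hi')).2 (by simpa using hxy)))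
      rcases eq_or_ne l i with rfl | hl
      · simpa using hσi
      · simpa [hl] using hσ l
    · exact key hσ (.upper rfl)
    · exact key hσ (.lower rfl)
    · exact key hσ (.inner ((blockRel_of_eq rfl).2 (.inl ⟨j, rfl, rfl⟩)))

theorem jpgRed_isFaceGraph (hG : ∀ i, (G i).IsFaceGraph) (hS : ∀ i, (S i).IsPyramidal) :
    (JPGred G S).IsFaceGraph := by
  obtain ⟨⟨τ, hτ⟩, h⟩ := jpg_isFaceGraph hG hS
  refine ⟨⟨τ, (jpg_isPerfectMatching_iff.1 hτ).1⟩, fun a b hab => ?_⟩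
  rcases hab with hab | ⟨rfl, rfl⟩
  · obtain ⟨τ, hτ, hab⟩ := h a b hab
    exact ⟨τ, (jpg_isPerfectMatching_iff.1 hτ).1, hab⟩
  · choose σ hσ using fun i => (hG i).1
    choose ρ hρ using fun i => (hS i).exists
    obtain ⟨τ, hτ, h, -⟩ := exists_jpgRed_isPerfectMatching_of_glue hρ hσ (.base rfl)
    exact ⟨τ, hτ, h⟩

end Glue

end BipGraph

/-! ### Convex hulls and Cayley sums from spanning points. -/

/-- A subspace is convex, so `K` contains the whole hull of `A`, and injectivity on `K` is enough.
-/
theorem affinelyIsomorphic_convexHull {E F : Type*} [AddCommGroup E] [Module ℝ E]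
    [AddCommGroup F] [Module ℝ F] (f : E →ₗ[ℝ] F) {A : Set E} {B : Set F} {K : Submodule ℝ E}
    (hAK : A ⊆ K) (hf : Set.InjOn f K) (hAB : f '' A = B) :
    AffinelyIsomorphic (convexHull ℝ A) (convexHull ℝ B) := by
  refine ⟨f.toAffineMap, ?_⟩
  have h : f.toAffineMap '' convexHull ℝ A = convexHull ℝ B := by
    rw [AffineMap.image_convexHull, ← hAB]
    rfl
  rw [← h]
  exact (hf.mono (convexHull_min hAK K.convex)).bijOn_image

theorem cayleySum_convexHull {κ E : Type*} [DecidableEq κ] [AddCommGroup E] [Module ℝ E]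
    (Q : κ → Set E) :
    cayleySum (fun i => convexHull ℝ (Q i)) =
      convexHull ℝ (⋃ i, Q i ×ˢ {(Pi.single i 1 : κ → ℝ)}) := by
  have h : ∀ i, convexHull ℝ (Q i) ×ˢ {(Pi.single i 1 : κ → ℝ)} =
      convexHull ℝ (Q i ×ˢ {(Pi.single i 1 : κ → ℝ)}) := fun i => by
    rw [convexHull_prod, convexHull_singleton]
  simp only [cayleySum, h]
  exact (convexHull ℝ).closure_iSup_closure fun i => Q i ×ˢ {(Pi.single i 1 : κ → ℝ)}

namespace BipGraph

/-- The permutation matrices of the perfect matchings. -/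
def vertexSet {U V : Type*} (G : BipGraph U V) : Set (Matrix U V ℝ) :=
  {M | ∃ σ : U ≃ V, G.IsPerfectMatching σ ∧ M = matchingMatrix σ}

/-! ### The linear map between the polytopes. -/

section Polytopes

variable {ι : Type*} {U V : ι → Type*} (G : ∀ i, BipGraph (U i) (V i))

open Classical in
/-- The vertices of the product of all faces, with the factor number `i` replaced by the zero
vector if `o = some i`. -/
def factorVertices (o : Option ι) : Set (∀ i, Matrix (U i) (V i) ℝ) :=
  Set.univ.pi fun i => if o = some i then {0} else (G i).vertexSet

theorem convexHull_factorVertices_none [Finite ι] :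
    convexHull ℝ (factorVertices G none) = Set.univ.pi fun i => (G i).face := by
  simp only [factorVertices, convexHull_pi]
  rfl

theorem convexHull_factorVertices_some [Finite ι] [DecidableEq ι] (j : ι) :
    convexHull ℝ (factorVertices G (some j)) = omitFactor (fun i => (G i).face) j := by
  rw [factorVertices, convexHull_pi, omitFactor]
  congr 1
  ext1 i
  rcases eq_or_ne i j with rfl | h
  · simp
  · rw [if_neg (by simpa using h.symm), Function.update_of_ne h]
    rfl

theorem joinedProduct_face [Finite ι] [DecidableEq ι] :
    joinedProduct (fun i => (G i).face) =
      convexHull ℝ (⋃ j, factorVertices G (some j) ×ˢ {(Pi.single j 1 : ι → ℝ)}) := by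
  rw [← cayleySum_convexHull, joinedProduct]
  simp only [convexHull_factorVertices_some]

theorem reducedJoinedProduct_face [Finite ι] [DecidableEq ι] :
    reducedJoinedProduct (fun i => (G i).face) =
      convexHull ℝ (⋃ o, factorVertices G o ×ˢ {(Pi.single o 1 : Option ι → ℝ)}) := by
  rw [← cayleySum_convexHull, reducedJoinedProduct]
  congr 1
  ext1 o
  cases o
  · exact (convexHull_factorVertices_none G).symm
  · exact (convexHull_factorVertices_some G _).symm

variable {G} (S : ∀ i, (G i).NodeChoice)

open Classical in
/-- The `0/1` matrix of the matching `NodeChoice.Star`. -/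
noncomputable def starMatrix {U V : Type*} {G : BipGraph U V} (S : G.NodeChoice)
    (ρ : ↥(Set.range S.up)ᶜ ≃ ↥(Set.range S.low)ᶜ) : Matrix U V ℝ :=
  Matrix.of fun x y => if S.Star ρ x y then 1 else 0

/-- The entries of a matrix on the edges of the joined product graph at the extra upper node. -/
def apexMap :
    Matrix (Option (Σ i, U i)) (Option (Σ i, V i)) ℝ →ₗ[ℝ] Option ι → ℝ where
  toFun M o := o.elim (M none none) fun i => M none (some ⟨i, (S i).low (Fin.last (S i).last)⟩)
  map_add' M N := by ext (_ | i) <;> rfl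
  map_smul' c M := by ext (_ | i) <;> rfl

/-- The diagonal blocks of a matrix, corrected by multiples of the matrices `starMatrix`. -/
noncomputable def blockMap (ρ : ∀ i, ↥(Set.range (S i).up)ᶜ ≃ ↥(Set.range (S i).low)ᶜ) :
    Matrix (Option (Σ i, U i)) (Option (Σ i, V i)) ℝ →ₗ[ℝ] ∀ i, Matrix (U i) (V i) ℝ where
  toFun M i := Matrix.of (fun x y => M (some ⟨i, x⟩) (some ⟨i, y⟩)) -
    apexMap S M (some i) • starMatrix (S i) (ρ i)
  map_add' M N := by
    ext i x y
    simp
    ring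
  map_smul' c M := by
    ext i x y
    simp
    ring

/-- The matrices that vanish between different blocks and at the non-edges of the two extra nodes,
and whose entries at the edges from the two extra nodes to a block agree. -/
def linkedMatrices : Submodule ℝ (Matrix (Option (Σ i, U i)) (Option (Σ i, V i)) ℝ) where
  carrier := {M |
    (∀ i y, y ≠ (S i).low (Fin.last (S i).last) → M none (some ⟨i, y⟩) = 0) ∧
    (∀ i x, x ≠ (S i).up 0 → M (some ⟨i, x⟩) none = 0) ∧
    (∀ i, M (some ⟨i, (S i).up 0⟩) none =
      M none (some ⟨i, (S i).low (Fin.last (S i).last)⟩)) ∧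
    ∀ i i' x y, i ≠ i' → M (some ⟨i, x⟩) (some ⟨i', y⟩) = 0}
  zero_mem' := by simp
  add_mem' {M N} hM hN := by
    refine ⟨fun i y h => ?_, fun i x h => ?_, fun i => ?_, fun i i' x y h => ?_⟩
    · simp [hM.1 i y h, hN.1 i y h]
    · simp [hM.2.1 i x h, hN.2.1 i x h]
    · simp [hM.2.2.1 i, hN.2.2.1 i]
    · simp [hM.2.2.2 i i' x y h, hN.2.2.2 i i' x y h]
  smul_mem' c M hM := by
    refine ⟨fun i y h => ?_, fun i x h => ?_, fun i => ?_, fun i i' x y h => ?_⟩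
    · simp [hM.1 i y h]
    · simp [hM.2.1 i x h]
    · simp [hM.2.2.1 i]
    · simp [hM.2.2.2 i i' x y h]

variable {S} {ρ : ∀ i, ↥(Set.range (S i).up)ᶜ ≃ ↥(Set.range (S i).low)ᶜ}

/-- The apex entries determine the row and, by the linking condition, the column of the extra nodes;
adding back the multiples of `starMatrix` recovers the diagonal blocks. All other entries vanish. -/
theorem linkedMatrices_ext {M N : Matrix (Option (Σ i, U i)) (Option (Σ i, V i)) ℝ}
    (hM : M ∈ linkedMatrices S) (hN : N ∈ linkedMatrices S)
    (hb : blockMap S ρ M = blockMap S ρ N) (ha : apexMap S M = apexMap S N) : M = N := by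
  have ha' : ∀ i, M none (some ⟨i, (S i).low (Fin.last (S i).last)⟩) =
      N none (some ⟨i, (S i).low (Fin.last (S i).last)⟩) := fun i => congrFun ha (some i)
  ext (_ | ⟨i, x⟩) (_ | ⟨i', y⟩)
  · exact congrFun ha none
  · by_cases h : y = (S i').low (Fin.last (S i').last)
    · rw [h, ha']
    · rw [hM.1 _ _ h, hN.1 _ _ h]
  · by_cases h : x = (S i).up 0
    · rw [h, hM.2.2.1, hN.2.2.1, ha']
    · rw [hM.2.1 _ _ h, hN.2.1 _ _ h]
  · by_cases h : i = i'
    · subst h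
      have := congrFun (congrFun (congrFun hb i) x) y
      simpa [blockMap, ha] using this
    · rw [hM.2.2.2 _ _ _ _ h, hN.2.2.2 _ _ _ _ h]

variable {o : Option ι} {σ : ∀ i, U i ≃ V i} {τ : Option (Σ i, U i) ≃ Option (Σ i, V i)}

open Classical in
theorem matchingMatrix_of_glue {R : ∀ i, U i → V i → Prop} (h : ∀ a b, Glue S o R a b ↔ τ a = b)
    (a b) : matchingMatrix τ a b = if Glue S o R a b then 1 else 0 := by
  simp [matchingMatrix, h]

open Classical in
theorem matchingMatrix_mem_linkedMatrices {R : ∀ i, U i → V i → Prop}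
    (h : ∀ a b, Glue S o R a b ↔ τ a = b) : matchingMatrix τ ∈ linkedMatrices S := by
  refine ⟨fun i y hy => ?_, fun i x hx => ?_, fun i => ?_, fun i i' x y hi => ?_⟩
  · simp [matchingMatrix_of_glue h, glue_none_some, hy]
  · simp [matchingMatrix_of_glue h, glue_some_none, hx]
  · have : Glue S o R (some ⟨i, (S i).up 0⟩) none ↔
        Glue S o R none (some ⟨i, (S i).low (Fin.last (S i).last)⟩) := by
      simp [glue_none_some, glue_some_none]
    rw [matchingMatrix_of_glue h, matchingMatrix_of_glue h]
    simp only [this]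
  · rw [matchingMatrix_of_glue h]
    exact if_neg fun h => hi h.fst_eq

theorem apexMap_matchingMatrix [DecidableEq ι] {R : ∀ i, U i → V i → Prop}
    (h : ∀ a b, Glue S o R a b ↔ τ a = b) : apexMap S (matchingMatrix τ) = Pi.single o 1 := by
  ext (_ | i)
  · simp [apexMap, matchingMatrix_of_glue h, glue_none_none, Pi.single_apply, eq_comm]
  · simp [apexMap, matchingMatrix_of_glue h, glue_none_some, Pi.single_apply, eq_comm]

open Classical in
-- Block `o` is exactly `starMatrix` and its apex entry is 1, so the correction cancels it; in the
-- other blocks the apex entry is 0.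
theorem blockMap_matchingMatrix (h : ∀ a b, Glue S o (blockRel S ρ o σ) a b ↔ τ a = b) (i : ι) :
    blockMap S ρ (matchingMatrix τ) i = if o = some i then 0 else matchingMatrix (σ i) := by
  ext x y
  have ha := congrFun (apexMap_matchingMatrix h) (some i)
  have hσ : matchingMatrix (σ i) x y = if σ i x = y then 1 else 0 := rfl
  by_cases ho : o = some i
  · simp [blockMap, ha, ho, matchingMatrix_of_glue h, glue_some_some, blockRel, starMatrix]
  · simp [blockMap, ha, ho, Ne.symm ho, matchingMatrix_of_glue h, glue_some_some, blockRel, hσ]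

theorem blockMap_mem_factorVertices (hσ : ∀ i, (G i).IsPerfectMatching (σ i))
    (h : ∀ a b, Glue S o (blockRel S ρ o σ) a b ↔ τ a = b) :
    blockMap S ρ (matchingMatrix τ) ∈ factorVertices G o := by
  intro i _
  rw [blockMap_matchingMatrix h]
  split_ifs with ho
  · simp [ho]
  · simpa [ho] using ⟨σ i, hσ i, rfl⟩

theorem exists_glue_of_mem_factorVertices (hG : ∀ i, ∃ σ : U i ≃ V i, (G i).IsPerfectMatching σ)
    {B : ∀ i, Matrix (U i) (V i) ℝ} (hB : B ∈ factorVertices G o) :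
    ∃ (σ : ∀ i, U i ≃ V i) (τ : Option (Σ i, U i) ≃ Option (Σ i, V i)),
      (∀ i, (G i).IsPerfectMatching (σ i)) ∧
      (∀ a b, Glue S o (blockRel S ρ o σ) a b ↔ τ a = b) ∧
      blockMap S ρ (matchingMatrix τ) = B := by
  have : ∀ i, ∃ σ : U i ≃ V i, (G i).IsPerfectMatching σ ∧
      (o = some i → B i = 0) ∧ (o ≠ some i → B i = matchingMatrix σ) := by
    intro i
    have hi := hB i trivial
    by_cases ho : o = some i
    · obtain ⟨σ, hσ⟩ := hG i
      -- In the attached block any perfect matching will do, since `blockRel` ignores it.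
      exact ⟨σ, hσ, fun _ => by simpa [ho] using hi, fun h => (h ho).elim⟩
    · simp only [if_neg ho] at hi
      obtain ⟨σ, hσ, h⟩ := hi
      exact ⟨σ, hσ, fun h => (ho h).elim, fun _ => h⟩
  choose σ hσ h0 h1 using this
  obtain ⟨τ, hτ⟩ := exists_equiv_glue S ρ o σ
  refine ⟨σ, τ, hσ, hτ, ?_⟩
  ext1 i
  rw [blockMap_matchingMatrix hτ]
  split_ifs with ho
  · exact (h0 i ho).symm
  · exact (h1 i ho).symm

/-! ### The two affine isomorphisms. -/

variable [Finite ι] [DecidableEq ι] [∀ i, Finite (U i)]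

theorem jpgRed_face_affinelyIsomorphic (hG : ∀ i, ∃ σ : U i ≃ V i, (G i).IsPerfectMatching σ)
    (hS : ∀ i, (S i).IsPyramidal) :
    AffinelyIsomorphic (JPGred G S).face (reducedJoinedProduct fun i => (G i).face) := by
  choose ρ hρ hρ' using hS
  rw [reducedJoinedProduct_face]
  refine affinelyIsomorphic_convexHull ((blockMap S ρ).prod (apexMap S)) (K := linkedMatrices S)
    ?_ ?_ ?_
  · rintro _ ⟨τ, hτ, rfl⟩
    obtain ⟨o, σ, hσ, h⟩ := exists_glue_of_jpgRed_isPerfectMatching hG hρ' hτ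
    exact matchingMatrix_mem_linkedMatrices h
  · intro M hM N hN h
    exact linkedMatrices_ext hM hN (congrArg Prod.fst h) (congrArg Prod.snd h)
  · ext ⟨B, l⟩
    simp only [Set.mem_iUnion, Set.mem_prod, Set.mem_singleton_iff]
    constructor
    · rintro ⟨_, ⟨τ, hτ, rfl⟩, h⟩
      obtain ⟨rfl, rfl⟩ := Prod.ext_iff.1 h
      obtain ⟨o, σ, hσ, h⟩ := exists_glue_of_jpgRed_isPerfectMatching hG hρ' hτ
      exact ⟨o, blockMap_mem_factorVertices hσ h, apexMap_matchingMatrix h⟩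
    · rintro ⟨o, hB, rfl⟩
      obtain ⟨σ, τ, hσ, hτ, h⟩ := exists_glue_of_mem_factorVertices (S := S) (ρ := ρ) hG hB
      exact ⟨_, ⟨τ, jpgRed_isPerfectMatching_of_glue hρ hσ hτ, rfl⟩,
        Prod.ext h (apexMap_matchingMatrix hτ)⟩

theorem jpg_face_affinelyIsomorphic (hG : ∀ i, ∃ σ : U i ≃ V i, (G i).IsPerfectMatching σ)
    (hS : ∀ i, (S i).IsPyramidal) :
    AffinelyIsomorphic (JPG G S).face (joinedProduct fun i => (G i).face) := by
  choose ρ hρ hρ' using hS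
  have hsingle : ∀ j : ι, LinearMap.funLeft ℝ ℝ (some : ι → Option ι) (Pi.single (some j) 1) =
      Pi.single j 1 := fun j => by
    ext i
    simp [LinearMap.funLeft_apply, Pi.single_apply]
  have hmatch : ∀ {τ}, (JPG G S).IsPerfectMatching τ → ∃ (j : ι) (σ : ∀ i, U i ≃ V i),
      (∀ i, (G i).IsPerfectMatching (σ i)) ∧
        ∀ a b, Glue S (some j) (blockRel S ρ (some j) σ) a b ↔ τ a = b := by
    intro τ hτ
    obtain ⟨hτ, hne⟩ := jpg_isPerfectMatching_iff.1 hτ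
    obtain ⟨_ | j, σ, hσ, h⟩ := exists_glue_of_jpgRed_isPerfectMatching hG hρ' hτ
    · exact (hne ((h _ _).1 (.base rfl))).elim
    · exact ⟨j, σ, hσ, h⟩
  rw [joinedProduct_face]
  refine affinelyIsomorphic_convexHull
    ((blockMap S ρ).prod ((LinearMap.funLeft ℝ ℝ some).comp (apexMap S)))
    -- The target has no coordinate for `none`; injectivity survives because the entry at (u, v)
    -- vanishes on all matchings of the unreduced graph.
    (K := linkedMatrices S ⊓ LinearMap.ker ((LinearMap.proj none).comp (apexMap S)))
    ?_ ?_ ?_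
  · rintro _ ⟨τ, hτ, rfl⟩
    obtain ⟨j, σ, hσ, h⟩ := hmatch hτ
    refine ⟨matchingMatrix_mem_linkedMatrices h, ?_⟩
    simp [apexMap_matchingMatrix h]
  · rintro M ⟨hM, hM0⟩ N ⟨hN, hN0⟩ h
    refine linkedMatrices_ext hM hN (congrArg Prod.fst h) ?_
    ext (_ | i)
    · exact (LinearMap.mem_ker.1 hM0).trans (LinearMap.mem_ker.1 hN0).symm
    · exact congrFun (congrArg Prod.snd h) i
  · ext ⟨B, l⟩
    simp only [Set.mem_iUnion, Set.mem_prod, Set.mem_singleton_iff]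
    constructor
    · rintro ⟨_, ⟨τ, hτ, rfl⟩, h⟩
      obtain ⟨rfl, rfl⟩ := Prod.ext_iff.1 h
      obtain ⟨j, σ, hσ, h⟩ := hmatch hτ
      refine ⟨j, blockMap_mem_factorVertices hσ h, ?_⟩
      rw [← hsingle, ← apexMap_matchingMatrix h]
      rfl
    · rintro ⟨j, hB, rfl⟩
      obtain ⟨σ, τ, hσ, hτ, h⟩ := exists_glue_of_mem_factorVertices (S := S) (ρ := ρ) hG hB
      refine ⟨_, ⟨τ, jpg_isPerfectMatching_iff.2
        ⟨jpgRed_isPerfectMatching_of_glue hρ hσ hτ, fun h0 => ?_⟩, rfl⟩, Prod.ext h ?_⟩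
      · simpa using glue_none_none.1 ((hτ _ _).2 h0)
      · rw [← hsingle, ← apexMap_matchingMatrix hτ]
        rfl

end Polytopes

end BipGraph

theorem mainTheorem7 (k : ℕ) (hk : 2 ≤ k) (U V : Fin k → Type*)
    [∀ i, Finite (U i)] [∀ i, Finite (V i)]
    (G : ∀ i, BipGraph (U i) (V i)) (hG : ∀ i, (G i).IsFaceGraph)
    (S : ∀ i, (G i).NodeChoice) (hS : ∀ i, (S i).IsPyramidal) :
    ((BipGraph.JPG G S).IsFaceGraph ∧
      AffinelyIsomorphic (BipGraph.JPG G S).face (joinedProduct fun i => (G i).face)) ∧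
    ((BipGraph.JPGred G S).IsFaceGraph ∧
      AffinelyIsomorphic (BipGraph.JPGred G S).face
        (reducedJoinedProduct fun i => (G i).face)) := by
  have : Nontrivial (Fin k) := Fin.nontrivial_iff_two_le.2 hk
  exact ⟨⟨BipGraph.jpg_isFaceGraph hG hS,
      BipGraph.jpg_face_affinelyIsomorphic (fun i => (hG i).1) hS⟩,
    BipGraph.jpgRed_isFaceGraph hG hS,
    BipGraph.jpgRed_face_affinelyIsomorphic (fun i => (hG i).1) hS⟩
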